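/- Conventions. All spaces are completely regular. For an ordinal $1\le\xi\le\omega_1$ the classes $\mathbf\Sigma^1_\xi$ of subsets of $\mathbb R$, or of the Baire space $\omega^\omega$, are defined as follows: $\mathbf\Sigma^1_1$ consists of the analytic sets; a set is $\mathbf\Pi^1_\xi$ if its complement is $\mathbf\Sigma^1_\xi$; for $\xi<\omega_1$, $\mathbf\Sigma^1_{\xi+1}$ consists of the continuous images (inside the same space) of $\mathbf\Pi^1_\xi$ sets; and for a limit ordinal $\alpha\le\omega_1$, $\mathbf\Sigma^1_\alpha$ consists of the unions $\bigcup_{i<\omega}Y_i$ with $Y_i\in\mathbf\Sigma^1_{\xi_i}$, $\xi_i<\alpha$. The sets in $\mathbf\Sigma^1_{\omega_1}$ are called $\sigma$-projective. The axiom $\sigma$-PD states that for every $\sigma$-projective $A\subseteq\omega^\omega$ the game of length $\omega$ in which two players alternately choose natural numbers, and the first player wins if and only if the resulting sequence is in $A$, is determined (one of the players has a winning strategy). A multifunction $F:B\to\mathcal P(X)$ between topological spaces is USCCV (upper semi-continuous compact-valued) if each $F(b)$ is compact and $\{b: F(b)\cap C\ne\emptyset\}$ is closed for every closed $C\subseteq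 X$. The space $X$ is a USCCV image of $B$ if there is such an $F$ with $\bigcup_{b\in B}F(b)=X$. Let $\mathscr K$ be the class of all (completely regular) spaces that are USCCV images of $\sigma$-projective subsets of $\mathbb R$. A space $X$ is Menger if for every sequence $\langle\mathcal U_n\rangle_{n\in\omega}$ of open covers of $X$ there are finite $\mathcal V_n\subseteq\mathcal U_n$ such that $\bigcup_n\mathcal V_n$ is an open cover of $X$. A $\gamma$-cover of $X$ is an infinite open cover such that every point of $X$ is in all but finitely many of its members. A space $X$ is Hurewicz if for every sequence $\langle\mathcal U_n\rangle_{n\in\omega}$ of open covers of $X$, none of which has a finite subcover, there are finite $\mathcal V_n\subseteq\mathcal U_n$ such that $\{\bigcup\mathcal V_n : n\in\omega\}$ is a $\gamma$-cover of $X$. Corollary. Assume $\sigma$-PD. Then every Menger space in $\mathscr K$ is Hurewicz. -/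

import Mathlib

open Set MeasureTheory

namespace KSigma

/-! ### The σ-projective hierarchy -/

/-- The boldface classes `Σ¹_ξ`, `1 ≤ ξ ≤ ω₁`, of subsets of an uncountable Polish space `X`
(used below for `X = ℝ` and for the Baire space `X = ℕ → ℕ`):
* `Σ¹₁` consists of the analytic sets;
* `Σ¹_{ξ+1}`, `ξ < ω₁`, consists of the continuous images of the `Π¹_ξ` sets, that is, of the sets
  whose complement is `Σ¹_ξ`;
* `Σ¹_α`, `α ≤ ω₁` a limit ordinal, consists of the unions of countably many sets each of which is
  in some `Σ¹_ξ` with `ξ < α`. -/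
inductive IsSigmaOne {X : Type*} [TopologicalSpace X] : Ordinal.{0} → Set X → Prop
  | analytic {s : Set X} (hs : AnalyticSet s) : IsSigmaOne 1 s
  | succ {ξ : Ordinal.{0}} (hξ : ξ < Ordinal.omega 1) {s : Set X} (hs : IsSigmaOne ξ sᶜ)
      {f : X → X} (hf : ContinuousOn f s) : IsSigmaOne (Order.succ ξ) (f '' s)
  | limit {α : Ordinal.{0}} (hα : α ≤ Ordinal.omega 1) (hlim : Order.IsSuccLimit α)
      {ξ : ℕ → Ordinal.{0}} (hξ : ∀ i, ξ i < α) {s : ℕ → Set X}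
      (hs : ∀ i, IsSigmaOne (ξ i) (s i)) : IsSigmaOne α (⋃ i, s i)

/-- The σ-projective sets are the sets in `Σ¹_{ω₁}`. -/
def IsSigmaProjective {X : Type*} [TopologicalSpace X] (s : Set X) : Prop :=
  IsSigmaOne (Ordinal.omega 1) s

/-! ### Games of length `ω` on the natural numbers -/

/-- The finite sequence `(x 0, …, x (n - 1))`. -/
def history (x : ℕ → ℕ) (n : ℕ) : List ℕ := (List.range n).map x

/-- `σ` is a winning strategy for player I (who plays at the even stages, and wins the run `x`
when `x ∈ A`) in the game with payoff set `A`. -/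
def IsWinningStrategyI (A : Set (ℕ → ℕ)) (σ : List ℕ → ℕ) : Prop :=
  ∀ x : ℕ → ℕ, (∀ n, x (2 * n) = σ (history x (2 * n))) → x ∈ A

/-- `τ` is a winning strategy for player II (who plays at the odd stages, and wins the run `x`
when `x ∉ A`) in the game with payoff set `A`. -/
def IsWinningStrategyII (A : Set (ℕ → ℕ)) (τ : List ℕ → ℕ) : Prop :=
  ∀ x : ℕ → ℕ, (∀ n, x (2 * n + 1) = τ (history x (2 * n + 1))) → x ∉ A

/-- The game with payoff set `A` is determined: one of the players has a winning strategy. -/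
def Determined (A : Set (ℕ → ℕ)) : Prop :=
  (∃ σ, IsWinningStrategyI A σ) ∨ ∃ τ, IsWinningStrategyII A τ

/-- The axiom of σ-projective determinacy, σ-PD. -/
def SigmaPD : Prop :=
  ∀ A : Set (ℕ → ℕ), IsSigmaProjective A → Determined A

/-! ### Multifunctions and the class of K-σ-projective spaces -/

/-- An upper semi-continuous compact-valued multifunction. (`UpperHemicontinuous F` says that
`{x | F x ⊆ U}` is open for each open `U`; equivalently, `{x | (F x ∩ C).Nonempty}` is closed for
each closed `C`.) -/
def IsUSCCV {X Y : Type*} [TopologicalSpace X] [TopologicalSpace Y] (F : X → Set Y) : Prop :=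
  UpperHemicontinuous F ∧ ∀ x, IsCompact (F x)

/-- `Y` is a USCCV image of `X`. -/
def IsUSCCVImage (X Y : Type*) [TopologicalSpace X] [TopologicalSpace Y] : Prop :=
  ∃ F : X → Set Y, IsUSCCV F ∧ ⋃ x, F x = univ

/-- `Y` is a USCCV image of a σ-projective set of reals. -/
def IsKSigmaProjective (Y : Type*) [TopologicalSpace Y] : Prop :=
  ∃ B : Set ℝ, IsSigmaProjective B ∧ IsUSCCVImage B Y

/-! ### Selection principles -/

/-- `U` is an open cover of the space `X`. -/
def IsOpenCovering {X : Type*} [TopologicalSpace X] (U : Set (Set X)) : Prop :=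
  (∀ u ∈ U, IsOpen u) ∧ ⋃₀ U = univ

/-- A γ-cover: an infinite open cover such that each point is in all but finitely many members. -/
def IsGammaCover {X : Type*} [TopologicalSpace X] (U : Set (Set X)) : Prop :=
  IsOpenCovering U ∧ U.Infinite ∧ ∀ x : X, {u ∈ U | x ∉ u}.Finite

/-- The Menger property. -/
def IsMenger (X : Type*) [TopologicalSpace X] : Prop :=
  ∀ U : ℕ → Set (Set X), (∀ n, IsOpenCovering (U n)) →
    ∃ V : ℕ → Set (Set X), (∀ n, V n ⊆ U n ∧ (V n).Finite) ∧ IsOpenCovering (⋃ n, V n)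

/-- The Hurewicz property. -/
def IsHurewicz (X : Type*) [TopologicalSpace X] : Prop :=
  ∀ U : ℕ → Set (Set X), (∀ n, IsOpenCovering (U n)) →
    (∀ n, ¬ ∃ W ⊆ U n, W.Finite ∧ ⋃₀ W = univ) →
    ∃ V : ℕ → Set (Set X), (∀ n, V n ⊆ U n ∧ (V n).Finite) ∧
      IsGammaCover (range fun n => ⋃₀ V n)

end KSigma

open Topology Filter

namespace KSigma

/-! ### Closure properties of the σ-projective sets -/

section Hierarchy

variable {X : Type*} [TopologicalSpace X]

/-! Given open covers without finite subcovers, the Menger property makes them countable; let `W n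
k` be the union of the first `k` members of the `n`-th. In the covering game player I names `n`,
player II answers `k`, and I wins if some point is never covered. For a USCCV image of a
σ-projective `B`, the payoff is the projection of a relatively closed subset of `B × ω^ω`, hence
σ-projective, and the game is determined (`isSigmaProjective_coverGame`). The Menger property rules
out a winning strategy for I (`not_isWinningStrategyI`). A winning strategy for II yields one
sequence `g` with every point in almost all `W n (g n)`
(`exists_eventually_mem_of_isWinningStrategyII`), which is the Hurewicz property. -/

theorem isSuccLimit_omega_one : Order.IsSuccLimit (Ordinal.omega 1) :=
  Cardinal.isSuccLimit_omega 1

/-- Countably many levels below `ω₁` have a supremum below `ω₁`; adding `ω` gives a limit level,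
still below `ω₁`, at which the union can already be formed. -/
theorem IsSigmaProjective.exists_lt {s : Set X} (hs : IsSigmaProjective s) :
    ∃ ξ < Ordinal.omega 1, IsSigmaOne ξ s := by
  unfold IsSigmaProjective at hs
  generalize hα : Ordinal.omega 1 = α at hs
  cases hs with
  | analytic hs =>
    exact absurd hα (Ordinal.one_lt_omega0.trans Ordinal.omega0_lt_omega_one).ne'
  | succ hξ hs hf =>
    have := isSuccLimit_omega_one
    rw [hα] at this
    exact absurd this (Order.not_isSuccLimit_succ _)
  | @limit _ hle hlim ξ hξ s hs =>
    subst hα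
    have hsup : (⨆ i, ξ i) < Ordinal.omega 1 := Ordinal.iSup_lt_omega_one hξ
    have hlt : (⨆ i, ξ i) + Ordinal.omega0 < Ordinal.omega 1 :=
      Ordinal.isPrincipal_add_omega 1 hsup Ordinal.omega0_lt_omega_one
    refine ⟨_, hlt, .limit hlt.le (Ordinal.isSuccLimit_add _ Ordinal.isSuccLimit_omega0)
      (fun i => ?_) hs⟩
    calc ξ i ≤ ⨆ i, ξ i := Ordinal.le_iSup ξ i
      _ < _ := by simp

theorem IsSigmaOne.isSigmaProjective {ξ : Ordinal.{0}} (hξ : ξ < Ordinal.omega 1) {s : Set X}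
    (hs : IsSigmaOne ξ s) : IsSigmaProjective s := by
  rw [← iUnion_const (ι := ℕ) s]
  exact .limit le_rfl isSuccLimit_omega_one (fun _ => hξ) fun _ => hs

theorem _root_.MeasureTheory.AnalyticSet.isSigmaProjective {s : Set X} (hs : AnalyticSet s) :
    IsSigmaProjective s :=
  (IsSigmaOne.analytic hs).isSigmaProjective
    (Ordinal.one_lt_omega0.trans Ordinal.omega0_lt_omega_one)

theorem IsSigmaProjective.compl {s : Set X} (hs : IsSigmaProjective s) :
    IsSigmaProjective sᶜ := by
  obtain ⟨ξ, hξ, h⟩ := hs.exists_lt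
  have := IsSigmaOne.succ hξ (s := sᶜ) (by rwa [compl_compl]) (f := id) continuousOn_id
  rw [image_id] at this
  exact this.isSigmaProjective (isSuccLimit_omega_one.succ_lt hξ)

theorem IsSigmaProjective.iUnion {s : ℕ → Set X} (hs : ∀ i, IsSigmaProjective (s i)) :
    IsSigmaProjective (⋃ i, s i) := by
  choose ξ hξ h using fun i => (hs i).exists_lt
  exact .limit le_rfl isSuccLimit_omega_one hξ h

theorem IsSigmaProjective.union {s t : Set X} (hs : IsSigmaProjective s)
    (ht : IsSigmaProjective t) : IsSigmaProjective (s ∪ t) := by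
  have : s ∪ t = ⋃ i : ℕ, if i = 0 then s else t := by
    ext x
    simp only [mem_union, mem_iUnion]
    constructor
    · rintro (h | h)
      exacts [⟨0, by simpa⟩, ⟨1, by simpa⟩]
    · rintro ⟨i, h⟩
      split_ifs at h
      exacts [Or.inl h, Or.inr h]
  rw [this]
  refine .iUnion fun i => ?_
  split_ifs
  exacts [hs, ht]

theorem IsSigmaProjective.inter {s t : Set X} (hs : IsSigmaProjective s)
    (ht : IsSigmaProjective t) : IsSigmaProjective (s ∩ t) := by
  rw [← compl_compl (s ∩ t), compl_inter]
  exact (hs.compl.union ht.compl).compl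

theorem IsSigmaProjective.image {s : Set X} (hs : IsSigmaProjective s) {f : X → X}
    (hf : ContinuousOn f s) : IsSigmaProjective (f '' s) := by
  obtain ⟨ξ, hξ, h⟩ := hs.compl.exists_lt
  exact (IsSigmaOne.succ hξ h hf).isSigmaProjective (isSuccLimit_omega_one.succ_lt hξ)

end Hierarchy

/-! ### Sets with σ-projective preimages in the Baire space -/

/-- A set all of whose preimages under Borel maps from the Baire space are σ-projective. -/
def PullbackSigmaProjective {X : Type*} [MeasurableSpace X] (s : Set X) : Prop :=
  ∀ f : (ℕ → ℕ) → X, Measurable f → IsSigmaProjective (f ⁻¹' s)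

namespace PullbackSigmaProjective

variable {X Y : Type*} [MeasurableSpace X] [MeasurableSpace Y]

theorem of_measurableSet {s : Set X} (hs : MeasurableSet s) : PullbackSigmaProjective s :=
  fun _ hf => (hf hs).analyticSet.isSigmaProjective

theorem preimage {s : Set X} (hs : PullbackSigmaProjective s) {g : Y → X} (hg : Measurable g) :
    PullbackSigmaProjective (g ⁻¹' s) :=
  fun f hf => hs (g ∘ f) (hg.comp hf)

theorem inter {s t : Set X} (hs : PullbackSigmaProjective s) (ht : PullbackSigmaProjective t) :
    PullbackSigmaProjective (s ∩ t) :=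
  fun f hf => (hs f hf).inter (ht f hf)

/-- The hierarchy allows only images inside one space, so the witness and the point are interleaved
into a single sequence and the projection becomes reading off the odd coordinates. -/
theorem image_snd [TopologicalSpace X] [PolishSpace X] [BorelSpace X] {R : Set (X × Y)}
    (hR : PullbackSigmaProjective R) : PullbackSigmaProjective (Prod.snd '' R) := by
  rcases isEmpty_or_nonempty X with hX | hX
  · rw [eq_empty_of_isEmpty R, image_empty]
    exact of_measurableSet .empty
  intro f hf
  obtain ⟨q, hq, hqs⟩ := PolishSpace.exists_nat_nat_continuous_surjective X
  let l : (ℕ → ℕ) → ℕ → ℕ := fun w n => w (2 * n)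
  let r : (ℕ → ℕ) → ℕ → ℕ := fun w n => w (2 * n + 1)
  have hl : Continuous l := by fun_prop
  have hr : Continuous r := by fun_prop
  have hmeas : Measurable fun w => (q (l w), f (r w)) :=
    ((hq.comp hl).measurable).prodMk (hf.comp hr.measurable)
  convert (hR _ hmeas).image hr.continuousOn
  ext v
  simp only [mem_preimage, mem_image, Prod.exists, exists_eq_right]
  constructor
  · rintro ⟨x, hx⟩
    obtain ⟨u, rfl⟩ := hqs x
    have e₁ : l (fun n => if n % 2 = 0 then u (n / 2) else v (n / 2)) = u := by
      ext n; simp [l]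
    have e₂ : r (fun n => if n % 2 = 0 then u (n / 2) else v (n / 2)) = v := by
      ext n; simp [r, Nat.add_mod, Nat.mul_add_div]
    exact ⟨fun n => if n % 2 = 0 then u (n / 2) else v (n / 2), by rwa [e₁, e₂], e₂⟩
  · rintro ⟨w, hw, rfl⟩
    exact ⟨_, hw⟩

/-- The projection of a relatively closed subset of `s × Y`. -/
theorem image_of_isClosed [TopologicalSpace X] [PolishSpace X] [BorelSpace X]
    [TopologicalSpace Y] [SecondCountableTopology Y] [BorelSpace Y]
    {s : Set X} (hs : PullbackSigmaProjective s) {Q : Set (s × Y)} (hQ : IsClosed Q) :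
    PullbackSigmaProjective {y | ∃ a, (a, y) ∈ Q} := by
  have hind : IsInducing (Prod.map Subtype.val id : s × Y → X × Y) :=
    IsInducing.subtypeVal.prodMap .id
  obtain ⟨C, hC, rfl⟩ := hind.isClosed_iff.1 hQ
  convert ((hs.preimage measurable_fst).inter (of_measurableSet hC.measurableSet)).image_snd
  ext y
  simp

end PullbackSigmaProjective

/-- This carries σ-projectivity from `ℝ` to the Baire space, where determinacy applies. Images are
handled as projections of graphs. -/
theorem IsSigmaOne.pullbackSigmaProjective {X : Type*} [TopologicalSpace X] [PolishSpace X]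
    [MeasurableSpace X] [BorelSpace X] {ξ : Ordinal.{0}} {s : Set X} (hs : IsSigmaOne ξ s) :
    PullbackSigmaProjective s := by
  induction hs with
  | @analytic s hs =>
    rw [AnalyticSet] at hs
    rcases hs with rfl | ⟨g, hg, rfl⟩
    · exact .of_measurableSet .empty
    · have hcl : IsClosed {p : ↥(univ : Set (ℕ → ℕ)) × X | g p.1.1 = p.2} :=
        isClosed_eq (by fun_prop) continuous_snd
      convert (PullbackSigmaProjective.of_measurableSet .univ).image_of_isClosed hcl
      ext y
      simp
  | @succ ξ hξ s hs f hf ih =>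
    have hsP : PullbackSigmaProjective s := fun g hg => by
      simpa using (ih g hg).compl
    have hcl : IsClosed {p : s × X | s.domRestrict f p.1 = p.2} :=
      isClosed_eq (hf.domRestrict.comp continuous_fst) continuous_snd
    convert hsP.image_of_isClosed hcl
    ext y
    simp [Set.domRestrict]
  | limit hα hlim hξ hs ih =>
    intro f hf
    rw [preimage_iUnion]
    exact .iUnion fun i => ih i f hf

/-! ### The covering game -/

theorem history_succ (x : ℕ → ℕ) (n : ℕ) : history x (n + 1) = history x n ++ [x n] := by
  simp [history, List.range_succ]

theorem length_history (x : ℕ → ℕ) (n : ℕ) : (history x n).length = n := by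
  simp [history]

/-- A run of a game can be prescribed by a rule giving each move from the preceding ones. -/
theorem exists_run (ρ : List ℕ → ℕ) : ∃ x : ℕ → ℕ, ∀ n, x n = ρ (history x n) := by
  let H : ℕ → List ℕ := fun n => Nat.rec [] (fun _ h => h ++ [ρ h]) n
  have hH : ∀ n, history (fun n => ρ (H n)) n = H n := by
    intro n
    induction n with
    | zero => rfl
    | succ n ih => rw [history_succ, ih]
  exact ⟨fun n => ρ (H n), fun n => by rw [hH]⟩

variable {X : Type*}

/-- `p` is never covered in the run `x` of the game in which player I chooses an index `n` and
player II answers with an index `k`, thereby covering the points of `W n k`. -/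
def Escapes (W : ℕ → ℕ → Set X) (x : ℕ → ℕ) (p : X) : Prop :=
  ∀ i, p ∉ W (x (2 * i)) (x (2 * i + 1))

/-- The payoff set of the covering game: some point is never covered. -/
def coverGame (W : ℕ → ℕ → Set X) : Set (ℕ → ℕ) := {x | ∃ p, Escapes W x p}

theorem exists_eventually_mem_of_isWinningStrategyII {W : ℕ → ℕ → Set X}
    (hmono : ∀ n, Monotone (W n)) {τ : List ℕ → ℕ}
    (hτ : IsWinningStrategyII (coverGame W) τ) :
    ∃ g : ℕ → ℕ, ∀ p, ∀ᶠ n in atTop, p ∈ W n (g n) := by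
  -- Otherwise I could answer every history with an index at which `τ` fails to cover `p`, and so
  -- defeat `τ`.
  have key : ∀ p, ∃ h : List ℕ, ∀ n, p ∈ W n (τ (h ++ [n])) := by
    by_contra! hcon
    obtain ⟨p, hp⟩ := hcon
    choose m hm using hp
    obtain ⟨x, hx⟩ := exists_run fun h => if h.length % 2 = 0 then m h else τ h
    have hx₀ : ∀ n, x (2 * n) = m (history x (2 * n)) := fun n => by
      conv_lhs => rw [hx]
      simp [length_history]
    have hx₁ : ∀ n, x (2 * n + 1) = τ (history x (2 * n + 1)) := fun n => by
      conv_lhs => rw [hx]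
      simp [length_history, Nat.add_mod]
    refine hτ x hx₁ ⟨p, fun i => ?_⟩
    rw [hx₁, history_succ, hx₀]
    exact hm _
  -- The maximum of the answers of `τ` over histories with code at most `n`; it dominates the answer
  -- for the history attached to `p` once `n` reaches its code.
  refine ⟨fun n => (Finset.range (n + 1)).sup fun j =>
    τ (((Encodable.decode j : Option (List ℕ)).getD []) ++ [n]), fun p => ?_⟩
  obtain ⟨h, hh⟩ := key p
  filter_upwards [eventually_ge_atTop (Encodable.encode h)] with n hn
  refine hmono n ?_ (hh n)
  have := Finset.le_sup (f := fun j =>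
    τ (((Encodable.decode j : Option (List ℕ)).getD []) ++ [n]))
    (Finset.mem_range.2 (Nat.lt_succ_of_le hn))
  simpa using this

variable [TopologicalSpace X]

/-- After a history `h`, an answer of at least `k (σ h)` would cover a whole neighbourhood of `p`.
Each of the finitely many histories thus has finitely many continuations that let a nearby point
escape. -/
theorem exists_nhds_finite_history {W : ℕ → ℕ → Set X} (hW : ∀ n k, IsOpen (W n k))
    (hmono : ∀ n, Monotone (W n)) (hcov : ∀ n p, ∃ k, p ∈ W n k) (σ : List ℕ → ℕ) (p : X)
    (i : ℕ) : ∃ U ∈ 𝓝 p, ∃ S : Finset (List ℕ), ∀ q ∈ U, ∀ x : ℕ → ℕ,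
      (∀ n, x (2 * n) = σ (history x (2 * n))) → Escapes W x q → history x (2 * i) ∈ S := by
  induction i with
  | zero => exact ⟨univ, univ_mem, {[]}, fun q _ x _ _ => by simp [history]⟩
  | succ i ih =>
    obtain ⟨U, hU, S, hS⟩ := ih
    choose k hk using fun n => hcov n p
    refine ⟨U ∩ ⋂ h ∈ S, W (σ h) (k (σ h)), inter_mem hU ((S.iInter_mem_sets).2 fun h _ =>
      (hW _ _).mem_nhds (hk _)), S.biUnion fun h => (Finset.range (k (σ h))).image
      fun c => h ++ [σ h, c], fun q hq x hx hesc => ?_⟩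
    have hmem := hS q hq.1 x hx hesc
    have hqW : q ∈ W (σ (history x (2 * i))) (k (σ (history x (2 * i)))) :=
      mem_iInter₂.1 hq.2 _ hmem
    simp only [Finset.mem_biUnion, Finset.mem_image, Finset.mem_range]
    refine ⟨_, hmem, x (2 * i + 1), ?_, ?_⟩
    · by_contra! hle
      exact hesc i (by rw [hx i]; exact hmono _ hle hqW)
    · rw [show 2 * (i + 1) = 2 * i + 1 + 1 by ring, history_succ, history_succ, ← hx i]
      simp

/-- Locally, II's `i`-th answer is bounded over all runs that follow `σ` and leave a point
uncovered. The Menger property selects finitely many such neighbourhoods for each `i`; II plays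
their common strict bound, so no point escapes. -/
theorem IsMenger.not_isWinningStrategyI (hM : IsMenger X) {W : ℕ → ℕ → Set X}
    (hW : ∀ n k, IsOpen (W n k)) (hmono : ∀ n, Monotone (W n)) (hcov : ∀ n p, ∃ k, p ∈ W n k)
    (σ : List ℕ → ℕ) : ¬ IsWinningStrategyI (coverGame W) σ := by
  intro hσ
  obtain ⟨V, hV, hVc⟩ := hM (fun i => {u | IsOpen u ∧ ∃ k, ∀ q ∈ u, ∀ x : ℕ → ℕ,
      (∀ n, x (2 * n) = σ (history x (2 * n))) → Escapes W x q → x (2 * i + 1) < k})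
    fun i => ⟨fun u hu => hu.1, by
      refine eq_univ_of_forall fun p => ?_
      obtain ⟨U, hU, S, hS⟩ := exists_nhds_finite_history hW hmono hcov σ p (i + 1)
      obtain ⟨O, hOU, hO, hpO⟩ := mem_nhds_iff.1 hU
      -- The last entry of a history of length `2 * (i + 1)` is II's `i`-th answer.
      refine ⟨O, ⟨hO, S.sup (fun h => h.getLastD 0) + 1, fun q hq x hx hesc => ?_⟩, hpO⟩
      have hmem := hS q (hOU hq) x hx hesc
      have := Finset.le_sup (f := fun h : List ℕ => h.getLastD 0) hmem
      rw [show 2 * (i + 1) = 2 * i + 1 + 1 by ring, history_succ] at this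
      simpa [Nat.lt_succ_iff] using this⟩
  have hbound : ∀ i, ∃ k, ∀ u ∈ V i, ∀ q ∈ u, ∀ x : ℕ → ℕ,
      (∀ n, x (2 * n) = σ (history x (2 * n))) → Escapes W x q → x (2 * i + 1) < k := by
    intro i
    choose! k hk using fun u (hu : u ∈ V i) => ((hV i).1 hu).2
    obtain ⟨m, hm⟩ := ((hV i).2.image k).bddAbove
    exact ⟨m, fun u hu q hq x hx hesc =>
      (hk u hu q hq x hx hesc).trans_le (hm (mem_image_of_mem k hu))⟩
  choose g hg using hbound
  obtain ⟨x, hx⟩ := exists_run fun h => if h.length % 2 = 0 then σ h else g (h.length / 2)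
  have hx₀ : ∀ n, x (2 * n) = σ (history x (2 * n)) := fun n => by
    conv_lhs => rw [hx]
    simp [length_history]
  have hx₁ : ∀ n, x (2 * n + 1) = g n := fun n => by
    conv_lhs => rw [hx]
    simp [length_history, Nat.add_mod, Nat.mul_add_div]
  obtain ⟨p, hp⟩ := hσ x hx₀
  obtain ⟨u, hu, hpu⟩ := hVc.2.symm ▸ mem_univ p
  obtain ⟨i, hi⟩ := mem_iUnion.1 hu
  exact (hg i u hi p hpu x hx₀ hp).ne (hx₁ i)

/-! ### The payoff set of the covering game is σ-projective -/

/-- If nothing in `F b` escapes, compactness leaves finitely many rounds that cover `F b`; this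
persists for nearby `b'` by upper semicontinuity and for runs agreeing on those rounds. -/
theorem isClosed_inter_nonempty {B : Type*} [TopologicalSpace B] {F : B → Set X}
    (hF : IsUSCCV F) {W : ℕ → ℕ → Set X} (hW : ∀ n k, IsOpen (W n k)) :
    IsClosed {q : B × (ℕ → ℕ) | ∃ p ∈ F q.1, Escapes W q.2 p} := by
  rw [← isOpen_compl_iff, isOpen_iff_mem_nhds]
  rintro ⟨b, x⟩ hbx
  have hempty : F b ∩ ⋂ i, (W (x (2 * i)) (x (2 * i + 1)))ᶜ = ∅ := by
    refine eq_empty_of_forall_notMem fun p hp => hbx ⟨p, hp.1, fun i => ?_⟩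
    exact mem_iInter.1 hp.2 i
  obtain ⟨t, ht⟩ := (hF.2 b).elim_finite_subfamily_closed _
    (fun i => (hW _ _).isClosed_compl) hempty
  have hsub : F b ⊆ ⋃ i ∈ t, W (x (2 * i)) (x (2 * i + 1)) := by
    intro p hp
    by_contra hcon
    have : p ∈ F b ∩ ⋂ i ∈ t, (W (x (2 * i)) (x (2 * i + 1)))ᶜ := by
      refine ⟨hp, ?_⟩
      simpa using hcon
    rwa [ht] at this
  have hb : ∀ᶠ b' in 𝓝 b, F b' ⊆ ⋃ i ∈ t, W (x (2 * i)) (x (2 * i + 1)) :=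
    (hF.1.upperHemicontinuousAt b).forall_isOpen _
      (isOpen_biUnion fun i _ => hW _ _) hsub
  have hcoord : ∀ m, ∀ᶠ x' : ℕ → ℕ in 𝓝 x, x' m = x m := fun m =>
    (continuous_apply m).continuousAt.eventually_mem (isOpen_discrete {x m} |>.mem_nhds rfl)
  have hx : ∀ᶠ x' : ℕ → ℕ in 𝓝 x, ∀ i ∈ t,
      x' (2 * i) = x (2 * i) ∧ x' (2 * i + 1) = x (2 * i + 1) :=
    (Filter.eventually_all_finset t).2 fun i _ => (hcoord _).and (hcoord _)
  filter_upwards [hb.prod_nhds hx]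
  rintro ⟨b', x'⟩ ⟨h₁, h₂⟩ ⟨p, hp, hesc⟩
  obtain ⟨i, hi, hpi⟩ := mem_iUnion₂.1 (h₁ hp)
  refine hesc i ?_
  obtain ⟨e₁, e₂⟩ := h₂ i hi
  rw [e₁, e₂]
  exact hpi

theorem IsKSigmaProjective.isSigmaProjective_coverGame (hK : IsKSigmaProjective X)
    {W : ℕ → ℕ → Set X} (hW : ∀ n k, IsOpen (W n k)) : IsSigmaProjective (coverGame W) := by
  obtain ⟨B, hB, F, hF, hFX⟩ := hK
  have h := (IsSigmaOne.pullbackSigmaProjective hB).image_of_isClosed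
    (isClosed_inter_nonempty hF hW)
  convert h id measurable_id
  ext x
  simp only [coverGame, mem_ofPred_eq, preimage_id]
  constructor
  · rintro ⟨p, hp⟩
    obtain ⟨b, hb⟩ := mem_iUnion.1 (hFX.symm ▸ mem_univ p)
    exact ⟨b, p, hb, hp⟩
  · rintro ⟨_, p, _, hp⟩
    exact ⟨p, hp⟩

/-! ### Menger and Hurewicz spaces -/

theorem IsMenger.exists_countable_subcover (hM : IsMenger X) {U : Set (Set X)}
    (hU : IsOpenCovering U) : ∃ V ⊆ U, V.Countable ∧ ⋃₀ V = univ := by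
  obtain ⟨V, hV, hc⟩ := hM (fun _ => U) fun _ => hU
  exact ⟨_, iUnion_subset fun n => (hV n).1, countable_iUnion fun n => (hV n).2.countable, hc.2⟩

theorem isGammaCover_range {W : ℕ → Set X} (hW : ∀ n, IsOpen (W n)) (hne : ∀ n, W n ≠ univ)
    (h : ∀ p, ∀ᶠ n in atTop, p ∈ W n) : IsGammaCover (range W) := by
  refine ⟨⟨forall_mem_range.2 hW, eq_univ_of_forall fun p => ?_⟩, fun hfin => ?_, fun p => ?_⟩
  · obtain ⟨n, hn⟩ := (h p).exists
    exact ⟨_, mem_range_self n, hn⟩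
  · obtain ⟨n, hn⟩ : ∃ n, (W ⁻¹' {W n}).Infinite := by
      by_contra! hcon
      refine infinite_univ (α := ℕ) (((hfin.biUnion (t := fun u => W ⁻¹' {u}) ?_)).subset
        fun n _ => mem_biUnion (mem_range_self n) rfl)
      rintro _ ⟨n, rfl⟩
      exact hcon n
    refine hne n (eq_univ_of_forall fun p => ?_)
    obtain ⟨m, hm, hpm⟩ := ((Nat.frequently_atTop_iff_infinite.2 hn).and_eventually (h p)).exists
    rw [← show W m = W n from hm]
    exact hpm
  · have hfin : {n | ¬ p ∈ W n}.Finite := by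
      have := h p
      rwa [← Nat.cofinite_eq_atTop, eventually_cofinite] at this
    refine (hfin.image W).subset ?_
    rintro _ ⟨⟨n, rfl⟩, hn⟩
    exact ⟨n, hn, rfl⟩

theorem IsMenger.isHurewicz_of_determined (hM : IsMenger X)
    (hdet : ∀ W : ℕ → ℕ → Set X, (∀ n k, IsOpen (W n k)) → Determined (coverGame W)) :
    IsHurewicz X := by
  intro U hU hfin
  have hseq : ∀ n, ∃ u : ℕ → Set X, (∀ j, u j ∈ U n) ∧ ⋃ j, u j = univ := by
    intro n
    obtain ⟨V, hVU, hVc, hV⟩ := hM.exists_countable_subcover (hU n)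
    rcases V.eq_empty_or_nonempty with rfl | hne
    · exact absurd ⟨∅, empty_subset _, finite_empty, hV⟩ (hfin n)
    · obtain ⟨u, rfl⟩ := hVc.exists_eq_range hne
      exact ⟨u, fun j => hVU (mem_range_self j), by rwa [sUnion_range] at hV⟩
  choose u huU hu using hseq
  let W : ℕ → ℕ → Set X := fun n k => ⋃₀ (u n '' Iio k)
  have hW : ∀ n k, IsOpen (W n k) := fun n k =>
    isOpen_sUnion (forall_mem_image.2 fun j _ => (hU n).1 _ (huU n j))
  have hmono : ∀ n, Monotone (W n) := fun n k l hkl =>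
    sUnion_subset_sUnion (image_mono (Iio_subset_Iio hkl))
  have hcov : ∀ n p, ∃ k, p ∈ W n k := fun n p => by
    obtain ⟨j, hj⟩ := mem_iUnion.1 ((hu n).symm ▸ mem_univ p)
    exact ⟨j + 1, _, mem_image_of_mem _ (mem_Iio.2 j.lt_succ_self), hj⟩
  have hsub : ∀ n k, u n '' Iio k ⊆ U n := fun n k => image_subset_iff.2 fun j _ => huU n j
  have hfinite : ∀ n k, (u n '' Iio k).Finite := fun n k => (finite_Iio k).image _
  rcases hdet W hW with ⟨σ, hσ⟩ | ⟨τ, hτ⟩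
  · exact absurd hσ (hM.not_isWinningStrategyI hW hmono hcov σ)
  · obtain ⟨g, hg⟩ := exists_eventually_mem_of_isWinningStrategyII hmono hτ
    exact ⟨fun n => u n '' Iio (g n), fun n => ⟨hsub n _, hfinite n _⟩,
      isGammaCover_range (fun n => hW n (g n))
        (fun n hn => hfin n ⟨_, hsub n _, hfinite n _, hn⟩) hg⟩

end KSigma

theorem mainTheorem3 (hPD : KSigma.SigmaPD) (X : Type*) [TopologicalSpace X]
    [CompletelyRegularSpace X] (hK : KSigma.IsKSigmaProjective X) (hM : KSigma.IsMenger X) :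
    KSigma.IsHurewicz X :=
  hM.isHurewicz_of_determined fun _ hW => hPD _ (hK.isSigmaProjective_coverGame hW)
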